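/- Let $\alpha>0$ and let $k\ge 0$, $p\ge 2$ be integers. An $N(0,\alpha)$ Gaussian matrix is a real random matrix with independent entries, each of law $N(0,\alpha)$; $M^\dagger$ is the Moore–Penrose pseudo-inverse of $M$ and $\|\cdot\|_F$ the Frobenius norm. (1) Let $\Sigma_2$ be a deterministic real $q\times r$ matrix (in particular, $\Sigma_2=\mathrm{diag}(\sigma_{k+1},\sigma_{k+2},\dots)$), and let $G_1\in\mathbb R^{k\times(k+p)}$ and $G_2\in\mathbb R^{r\times(k+p)}$ be independent $N(0,\alpha)$ Gaussian matrices. Then $\|\Sigma_2G_2G_1^\dagger\|_F^2$ is integrable and $$\mathbb E\,\|\Sigma_2G_2G_1^\dagger\|_F^2=\frac{k}{p-1}\,\|\Sigma_2\|_F^2,$$ the same value for every variance $\alpha$, in particular as for $\alpha=1$. (2) Let $A$ be a real $m\times n$ matrix with singular values $\sigma_1\ge\sigma_2\ge\dots\ge\sigma_n\ge 0$ (the square roots of the eigenvalues of $A^\top A$, with multiplicity), let $\Sigma_2=\mathrm{diag}(\sigma_{k+1},\dots,\sigma_n)$ (empty if $k\ge n$), let $G\in\mathbb R^{n\times(k+p)}$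 be an $N(0,\alpha)$ Gaussian matrix, and let $Q$ be a random $m\times r$ matrix which almost surely has orthonormal columns ($Q^\top Q=I$) and satisfies $AG=QR$ for some matrix $R$ (for example the orthogonal factor of a QR factorization of $AG$). Then $\|A-QQ^\top A\|_F$ is integrable and $$\mathbb E\,\|A-QQ^\top A\|_F\le\sqrt{1+\frac{k}{p-1}}\;\|\Sigma_2\|_F.$$ -/

import Mathlib

open MeasureTheory ProbabilityTheory
open scoped Matrix NNReal Matrix.Norms.Frobenius

/-- `B` is a Moore–Penrose inverse of the real matrix `A`: the four Penrose conditions. -/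
structure IsMoorePenrose {a b : Type*} [Fintype a] [Fintype b]
    (A : Matrix a b ℝ) (B : Matrix b a ℝ) : Prop where
  mul_mul_self : A * B * A = A
  self_mul_mul : B * A * B = B
  symm_left : (A * B)ᵀ = A * B
  symm_right : (B * A)ᵀ = B * A

/-- Every real symmetric matrix has a symmetric generalized inverse commuting with it. -/
theorem exists_symm_pinv {a : Type*} [Fintype a] (H : Matrix a a ℝ) (hH : Hᵀ = H) :
    ∃ P : Matrix a a ℝ, Pᵀ = P ∧ P * H = H * P ∧ H * P * H = H ∧ P * H * P = P := by
  classical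
  have hH' : H.IsHermitian := by
    rw [Matrix.IsHermitian, Matrix.conjTranspose_eq_transpose_of_trivial, hH]
  obtain ⟨U, d, hU, hHU⟩ : ∃ (U : Matrix a a ℝ) (d : a → ℝ), Uᵀ * U = 1 ∧
      H = U * Matrix.diagonal d * Uᵀ := by
    refine ⟨hH'.eigenvectorUnitary, hH'.eigenvalues, ?_, ?_⟩
    · have h := Unitary.coe_star_mul_self hH'.eigenvectorUnitary
      rwa [Matrix.star_eq_conjTranspose, Matrix.conjTranspose_eq_transpose_of_trivial] at h
    · have h := hH'.spectral_theorem
      rw [Unitary.conjStarAlgAut_apply, Matrix.star_eq_conjTranspose,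
        Matrix.conjTranspose_eq_transpose_of_trivial] at h
      exact h
  have key : ∀ e f : a → ℝ, (U * Matrix.diagonal e * Uᵀ) * (U * Matrix.diagonal f * Uᵀ) =
      U * Matrix.diagonal (fun i => e i * f i) * Uᵀ := by
    intro e f
    calc (U * Matrix.diagonal e * Uᵀ) * (U * Matrix.diagonal f * Uᵀ)
        = U * Matrix.diagonal e * (Uᵀ * U) * Matrix.diagonal f * Uᵀ := by
          simp only [Matrix.mul_assoc]
      _ = _ := by rw [hU, Matrix.mul_one, Matrix.mul_assoc U, Matrix.diagonal_mul_diagonal]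
  refine ⟨U * Matrix.diagonal (fun i => (d i)⁻¹) * Uᵀ, ?_, ?_, ?_, ?_⟩
  · simp [Matrix.transpose_mul, Matrix.mul_assoc]
  · rw [hHU, key, key]
    simp only [mul_comm]
  · rw [hHU, key, key]
    simp only [mul_inv_mul_cancel]
  · rw [hHU, key, key]
    congr 3
    funext i
    by_cases h : d i = 0 <;> simp [h]

/-- Every real matrix has a Moore–Penrose inverse. -/
theorem exists_isMoorePenrose {a b : Type*} [Fintype a] [Fintype b] (A : Matrix a b ℝ) :
    ∃ B : Matrix b a ℝ, IsMoorePenrose A B := by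
  obtain ⟨P, hPs, hc, h1, h2⟩ := exists_symm_pinv (A * Aᵀ) (by simp [Matrix.transpose_mul])
  refine ⟨Aᵀ * P, ?_, ?_, ?_, ?_⟩
  · have h4 : (A * (Aᵀ * P) * A - A) * (A * (Aᵀ * P) * A - A)ᵀ = 0 := by
      have e : (A * (Aᵀ * P) * A - A)ᵀ = Aᵀ * (P * (A * Aᵀ)) - Aᵀ := by
        simp [Matrix.transpose_mul, hPs, Matrix.mul_assoc]
      have e2 : (A * (Aᵀ * P) * A - A) * Aᵀ = 0 := by
        rw [Matrix.sub_mul, sub_eq_zero]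
        simpa only [Matrix.mul_assoc] using h1
      rw [e, Matrix.mul_sub, ← Matrix.mul_assoc, e2, Matrix.zero_mul, sub_zero]
    rw [← Matrix.conjTranspose_eq_transpose_of_trivial] at h4
    exact sub_eq_zero.mp (Matrix.self_mul_conjTranspose_eq_zero.mp h4)
  · calc Aᵀ * P * A * (Aᵀ * P) = Aᵀ * (P * (A * Aᵀ) * P) := by simp only [Matrix.mul_assoc]
      _ = Aᵀ * P := by rw [h2]
  · calc (A * (Aᵀ * P))ᵀ = P * (A * Aᵀ) := by
          simp [Matrix.transpose_mul, hPs, Matrix.mul_assoc]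
      _ = A * (Aᵀ * P) := by rw [hc, Matrix.mul_assoc]
  · simp [Matrix.transpose_mul, hPs, Matrix.mul_assoc]

/-- A real matrix has only one Moore–Penrose inverse. -/
theorem IsMoorePenrose.unique {a b : Type*} [Fintype a] [Fintype b] {A : Matrix a b ℝ}
    {B C : Matrix b a ℝ} (hB : IsMoorePenrose A B) (hC : IsMoorePenrose A C) : B = C := by
  have h1 : A * B = A * C := by
    calc A * B = (A * B)ᵀ := hB.symm_left.symm
      _ = (A * C * A * B)ᵀ := by rw [hC.mul_mul_self]
      _ = (A * B)ᵀ * (A * C)ᵀ := by rw [← Matrix.transpose_mul]; simp only [Matrix.mul_assoc]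
      _ = A * B * A * C := by rw [hB.symm_left, hC.symm_left]; simp only [Matrix.mul_assoc]
      _ = A * C := by rw [hB.mul_mul_self]
  have h2 : B * A = C * A := by
    calc B * A = (B * A)ᵀ := hB.symm_right.symm
      _ = (B * (A * C * A))ᵀ := by rw [hC.mul_mul_self]
      _ = (C * A)ᵀ * (B * A)ᵀ := by rw [← Matrix.transpose_mul]; simp only [Matrix.mul_assoc]
      _ = C * (A * B * A) := by rw [hB.symm_right, hC.symm_right]; simp only [Matrix.mul_assoc]
      _ = C * A := by rw [hB.mul_mul_self]
  calc B = B * A * B := hB.self_mul_mul.symm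
    _ = C * (A * B) := by rw [h2, Matrix.mul_assoc]
    _ = C := by rw [h1, ← Matrix.mul_assoc, hC.self_mul_mul]

/-- The Moore–Penrose pseudo-inverse `A†` of a real matrix. -/
noncomputable def pinv {a b : Type*} [Fintype a] [Fintype b] (A : Matrix a b ℝ) :
    Matrix b a ℝ :=
  (exists_isMoorePenrose A).choose

theorem isMoorePenrose_pinv {a b : Type*} [Fintype a] [Fintype b] (A : Matrix a b ℝ) :
    IsMoorePenrose A (pinv A) :=
  (exists_isMoorePenrose A).choose_spec

/-- The family of all entries of a random matrix. -/
def entries {Ω a b : Type*} (G : Ω → Matrix a b ℝ) (ω : Ω) (ij : a × b) : ℝ := G ω ij.1 ij.2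

/-- An `N(0, α)` Gaussian random matrix: independent entries, each of law `N(0, α)`. -/
structure IsGaussianMatrix {Ω a b : Type*} [MeasurableSpace Ω] (P : Measure Ω) (α : ℝ≥0)
    (G : Ω → Matrix a b ℝ) : Prop where
  hasLaw : ∀ i j, HasLaw (fun ω => G ω i j) (gaussianReal 0 α) P
  indep : iIndepFun (fun (ij : a × b) (ω : Ω) => entries G ω ij) P

/-- `Σ₂ = diag(σ_{k+1}, σ_{k+2}, …, σ_n)`, the singular values of `A` beyond the first `k`,
in decreasing order. Mathlib's singular values are indexed from `0` and are zero from index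
`rank A` on. -/
noncomputable def tailSingularValues {m n : ℕ} (A : Matrix (Fin m) (Fin n) ℝ) (k : ℕ) :
    Matrix (Fin (n - k)) (Fin (n - k)) ℝ :=
  Matrix.diagonal fun j => (Matrix.toEuclideanLin A).singularValues (k + j)

/-! Part (1). For `G₁` of full row rank, column `i` of `G₁†` has squared norm equal to the inverse
squared distance from row `i` to the span of the other rows. Row `i` is independent of these. With
them frozen, rotation invariance (`orthonormal_comb`) makes that squared distance a sum of `(k + p)
- (k - 1) = p + 1` squares of independent `N(0, α)` variables, whose inverse has mean `1 / (α (p -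
1))`. Finiteness of such a mean also yields almost sure full rank. Since `G₂` has uncorrelated
entries of variance `α` and is independent of `G₁`, the second moment is `α ‖S‖²` times the sum of
the `k` column means, and `α` cancels.

Part (2). In a basis `V = (V₁, V₂)` of right singular vectors, `V₁ᵀ G` and `V₂ᵀ G` are independent
Gaussian matrices. The error `F = A - Q Qᵀ A` kills `G`, so a right inverse of `V₁ᵀ G` expresses `F
V₁` through `F V₂`. Projections being contractive, `‖F‖²` is at most `‖A V₂‖²` plus the quantity of
part (1) with `S = A V₂`. Taking means and using `(𝔼 X)² ≤ 𝔼 X²` concludes. -/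

section GaussianFamily

variable {Ω : Type*} [MeasurableSpace Ω] {P : Measure Ω} {α : ℝ≥0}

/-- A family of independent random variables, each of law `N(0, α)`. -/
structure IsGaussianFamily {ι : Type*} (P : Measure Ω) (α : ℝ≥0) (X : ι → Ω → ℝ) : Prop where
  hasLaw : ∀ i, HasLaw (X i) (gaussianReal 0 α) P
  indep : iIndepFun X P

theorem IsGaussianMatrix.family {a b : Type*} {G : Ω → Matrix a b ℝ}
    (hG : IsGaussianMatrix P α G) :
    IsGaussianFamily P α fun (ij : a × b) ω => entries G ω ij :=
  ⟨fun ij => hG.hasLaw ij.1 ij.2, hG.indep⟩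

theorem IsGaussianFamily.matrix {a b : Type*} {G : Ω → Matrix a b ℝ}
    (hG : IsGaussianFamily P α fun (ij : a × b) ω => G ω ij.1 ij.2) : IsGaussianMatrix P α G :=
  ⟨fun i j => hG.hasLaw (i, j), hG.indep⟩

namespace IsGaussianFamily

variable {ι κ : Type*} {X : ι → Ω → ℝ}

theorem precomp (hX : IsGaussianFamily P α X) {g : κ → ι} (hg : Function.Injective g) :
    IsGaussianFamily P α fun k => X (g k) :=
  ⟨fun k => hX.hasLaw (g k), hX.indep.precomp hg⟩

theorem memLp_two (hX : IsGaussianFamily P α X) (i : ι) : MemLp (X i) 2 P :=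
  (hX.hasLaw i).hasGaussianLaw.memLp_two

theorem integral_eq_zero (hX : IsGaussianFamily P α X) (i : ι) : ∫ ω, X i ω ∂P = 0 := by
  rw [(hX.hasLaw i).integral_eq, integral_id_gaussianReal]

theorem covariance_eq [DecidableEq ι] (hX : IsGaussianFamily P α X) (i j : ι) :
    cov[X i, X j; P] = if i = j then (α : ℝ) else 0 := by
  split_ifs with h
  · subst h
    rw [covariance_self (hX.hasLaw i).aemeasurable, (hX.hasLaw i).variance_eq,
      variance_id_gaussianReal]
  · exact (hX.indep.indepFun h).covariance_eq_zero (hX.memLp_two i) (hX.memLp_two j)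

theorem integral_mul_eq [DecidableEq ι] [IsProbabilityMeasure P]
    (hX : IsGaussianFamily P α X) (i j : ι) :
    ∫ ω, X i ω * X j ω ∂P = if i = j then (α : ℝ) else 0 := by
  have h := covariance_eq_sub (hX.memLp_two i) (hX.memLp_two j)
  rw [hX.covariance_eq, hX.integral_eq_zero, zero_mul, sub_zero] at h
  exact h.symm

variable [Fintype ι]

/-- Orthonormal linear combinations of independent `N(0, α)` variables are again independent
`N(0, α)` variables. -/
theorem orthonormal_comb [Fintype κ] [DecidableEq κ] (hX : IsGaussianFamily P α X)
    (M : Matrix κ ι ℝ) (hM : M * Mᵀ = 1) :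
    IsGaussianFamily P α fun k ω => ∑ i, M k i * X i ω := by
  classical
  have hP := hX.indep.isProbabilityMeasure
  have hjoint : HasGaussianLaw (fun ω => (X · ω)) P :=
    iIndepFun.hasGaussianLaw (fun i => (hX.hasLaw i).hasGaussianLaw) hX.indep
  let L : (ι → ℝ) →L[ℝ] (κ → ℝ) := (Matrix.mulVecLin M).toContinuousLinearMap
  have hY : HasGaussianLaw (fun ω => ((fun k ω => ∑ i, M k i * X i ω : κ → Ω → ℝ) · ω)) P :=
    hjoint.map_fun L
  have hcov : ∀ k l, cov[fun ω => ∑ i, M k i * X i ω, fun ω => ∑ i, M l i * X i ω; P]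
      = if k = l then (α : ℝ) else 0 := by
    intro k l
    rw [covariance_fun_sum_fun_sum (fun i => (hX.memLp_two i).const_mul _)
      (fun i => (hX.memLp_two i).const_mul _)]
    simp_rw [covariance_const_mul_left, covariance_const_mul_right, hX.covariance_eq]
    have h : (M * Mᵀ) k l = (1 : Matrix κ κ ℝ) k l := by rw [hM]
    rw [Matrix.mul_apply, Matrix.one_apply] at h
    have : ∀ i, ∑ j, M k i * (M l j * if i = j then (α : ℝ) else 0)
        = α * (M k i * Mᵀ i l) := by
      intro i
      simp [Matrix.transpose_apply]
      ring
    simp_rw [this]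
    rw [← Finset.mul_sum, h]
    split_ifs <;> simp
  -- The combinations are jointly Gaussian, as a linear image of a Gaussian vector, so zero
  -- covariances suffice for independence.
  refine ⟨fun k => ⟨(hY.eval k).aemeasurable, ?_⟩,
    hY.iIndepFun_of_covariance_eq_zero fun k l hkl => by rw [hcov, if_neg hkl]⟩
  rw [(hY.eval k).map_eq_gaussianReal]
  congr 1
  · rw [integral_finsetSum _ fun i _ => ((hX.memLp_two i).integrable one_le_two).const_mul _]
    simp [integral_const_mul, hX.integral_eq_zero]
  · rw [← covariance_self (hY.eval k).aemeasurable, hcov, if_pos rfl, Real.toNNReal_coe]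

end IsGaussianFamily

/-! ### Laplace transforms and the mean of an inverse sum of squares. -/

theorem integral_exp_neg_mul_sq_gaussianReal {t : ℝ} (ht : 0 ≤ t) (hα : α ≠ 0) :
    ∫ x, Real.exp (-t * x ^ 2) ∂(gaussianReal 0 α) = (1 + 2 * α * t) ^ (-(1 / 2) : ℝ) := by
  have hα' : (0 : ℝ) < α := by positivity
  rw [integral_gaussianReal_eq_integral_smul hα]
  have h : ∀ x : ℝ, gaussianPDFReal 0 α x • Real.exp (-t * x ^ 2)
      = (√(2 * Real.pi * α))⁻¹ * Real.exp (-(t + 1 / (2 * α)) * x ^ 2) := by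
    intro x
    rw [gaussianPDFReal, smul_eq_mul, mul_assoc, ← Real.exp_add]
    congr 2
    field_simp
    ring
  simp_rw [h]
  rw [integral_const_mul, integral_gaussian, ← Real.sqrt_inv, ← Real.sqrt_mul (by positivity),
    Real.rpow_neg (by positivity), ← Real.sqrt_eq_rpow, ← Real.sqrt_inv]
  congr 1
  field_simp
  ring

theorem IsGaussianFamily.integral_exp_neg_mul_sum_sq {κ : Type*} [Fintype κ] {Y : κ → Ω → ℝ}
    (hY : IsGaussianFamily P α Y) (hα : α ≠ 0) {t : ℝ} (ht : 0 ≤ t) :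
    ∫ ω, Real.exp (-t * ∑ k, Y k ω ^ 2) ∂P
      = (1 + 2 * α * t) ^ (-((Fintype.card κ : ℝ) / 2)) := by
  have h1 : (0 : ℝ) ≤ 1 + 2 * α * t := by positivity
  simp_rw [Finset.mul_sum, Real.exp_sum]
  rw [hY.indep.integral_fun_prod_comp (f := fun _ x => Real.exp (-t * x ^ 2))
    (fun k => (hY.hasLaw k).aemeasurable) (fun k => by fun_prop)]
  have h2 : ∀ k, ∫ ω, Real.exp (-t * Y k ω ^ 2) ∂P = (1 + 2 * α * t) ^ (-(1 / 2) : ℝ) := by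
    intro k
    rw [← integral_exp_neg_mul_sq_gaussianReal ht hα]
    exact (hY.hasLaw k).integral_comp (f := fun x => Real.exp (-t * x ^ 2)) (by fun_prop)
  simp_rw [h2]
  rw [Finset.prod_const, Finset.card_univ, ← Real.rpow_natCast, ← Real.rpow_mul h1]
  congr 1
  ring

/-- Trades an inverse for exponentials, whose means factor over independent variables. With values
in `ENNReal` it includes `s = 0`, where both sides are `⊤`, so the sum of squares need not be known
to be nonzero. -/
theorem ENNReal.inv_ofReal_eq_lintegral_exp {s : ℝ} (hs : 0 ≤ s) :
    (ENNReal.ofReal s)⁻¹ = ∫⁻ t in Set.Ioi (0 : ℝ), ENNReal.ofReal (Real.exp (-t * s)) := by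
  rcases hs.eq_or_lt with rfl | hs
  · simp
  · have h : ∀ t : ℝ, -t * s = -s * t := fun t => by ring
    simp_rw [h]
    rw [← ofReal_integral_eq_lintegral_ofReal (integrableOn_exp_mul_Ioi (by linarith) 0)
      (ae_of_all _ fun t => (Real.exp_pos _).le), integral_exp_mul_Ioi (by linarith),
      ← ENNReal.ofReal_inv_of_pos hs]
    congr 1
    simp

theorem lintegral_Ioi_one_add_mul_rpow {c : ℝ} (hc : 0 < c) {a : ℝ} (ha : 1 < a) :
    ∫⁻ t in Set.Ioi (0 : ℝ), ENNReal.ofReal ((1 + c * t) ^ (-a))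
      = ENNReal.ofReal (1 / (c * (a - 1))) := by
  have hd : ∀ x ∈ Set.Ici (0 : ℝ),
      HasDerivAt (fun t => -(1 / (c * (a - 1))) * (1 + c * t) ^ (1 - a))
        ((1 + c * x) ^ (-a)) x := by
    intro x hx
    have hx' : (0 : ℝ) ≤ x := hx
    have h1 : HasDerivAt (fun t : ℝ => 1 + c * t) c x := by
      simpa using ((hasDerivAt_id x).const_mul c).const_add 1
    have h2 := (h1.rpow_const (p := 1 - a)
      (Or.inl (by positivity))).const_mul (-(1 / (c * (a - 1))))
    refine h2.congr_deriv ?_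
    have h3 : a - 1 ≠ 0 := by linarith
    rw [show 1 - a - 1 = -a by ring]
    field_simp
    ring
  have hpos : ∀ x ∈ Set.Ioi (0 : ℝ), 0 ≤ (1 + c * x) ^ (-a) := by
    intro x hx
    have hx' : (0 : ℝ) < x := hx
    positivity
  have hlim : Filter.Tendsto (fun t => -(1 / (c * (a - 1))) * (1 + c * t) ^ (1 - a))
      Filter.atTop (nhds 0) := by
    have h1 : Filter.Tendsto (fun t : ℝ => 1 + c * t) Filter.atTop Filter.atTop :=
      Filter.tendsto_atTop_add_const_left _ _ (Filter.tendsto_id.const_mul_atTop hc)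
    have h2 := ((tendsto_rpow_neg_atTop (y := a - 1) (by linarith)).comp h1).const_mul
      (-(1 / (c * (a - 1))))
    simpa [Function.comp_def] using h2
  rw [← ofReal_integral_eq_lintegral_ofReal (integrableOn_Ioi_deriv_of_nonneg' hd hpos hlim)
    ((ae_restrict_iff' measurableSet_Ioi).2 (ae_of_all _ hpos)),
    integral_Ioi_of_hasDerivAt_of_nonneg' hd hpos hlim]
  simp

/-- The expected inverse of a sum of `m ≥ 3` independent squared `N(0, α)` variables is
`1 / (α (m - 2))`. -/
theorem IsGaussianFamily.lintegral_inv_sum_sq {κ : Type*} [Fintype κ] {Y : κ → Ω → ℝ}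
    (hY : IsGaussianFamily P α Y) (hα : 0 < α) (hκ : 3 ≤ Fintype.card κ) :
    ∫⁻ ω, (ENNReal.ofReal (∑ k, Y k ω ^ 2))⁻¹ ∂P
      = ENNReal.ofReal (1 / (α * ((Fintype.card κ : ℝ) - 2))) := by
  have hP := hY.indep.isProbabilityMeasure
  have hm : ∀ k, AEMeasurable (Y k) P := fun k => (hY.hasLaw k).aemeasurable
  have hs : ∀ ω, 0 ≤ ∑ k, Y k ω ^ 2 := fun ω => Finset.sum_nonneg fun k _ => sq_nonneg _
  simp_rw [fun ω => ENNReal.inv_ofReal_eq_lintegral_exp (hs ω)]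
  rw [lintegral_lintegral_swap]
  · have h : ∀ t ∈ Set.Ioi (0 : ℝ), ∫⁻ ω, ENNReal.ofReal (Real.exp (-t * ∑ k, Y k ω ^ 2)) ∂P
        = ENNReal.ofReal ((1 + 2 * α * t) ^ (-((Fintype.card κ : ℝ) / 2))) := by
      intro t ht
      have ht' : (0 : ℝ) ≤ t := le_of_lt ht
      rw [← hY.integral_exp_neg_mul_sum_sq hα.ne' ht', ofReal_integral_eq_lintegral_ofReal]
      · refine Integrable.of_bound (C := 1) ?_ (ae_of_all _ fun ω => ?_)
        · exact (AEMeasurable.exp ((Finset.aemeasurable_fun_sum _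
            fun k _ => (hm k).pow_const 2).const_mul (-t))).aestronglyMeasurable
        · rw [Real.norm_eq_abs, Real.abs_exp, Real.exp_le_one_iff, neg_mul]
          exact neg_nonpos.2 (mul_nonneg ht' (hs ω))
      · exact ae_of_all _ fun ω => (Real.exp_pos _).le
    rw [setLIntegral_congr_fun measurableSet_Ioi h, lintegral_Ioi_one_add_mul_rpow]
    · congr 2
      ring
    · have : (0 : ℝ) < α := hα
      positivity
    -- The exponent is half the number of variables; convergence at infinity needs it above 1, hence
    -- three variables.
    · have : (3 : ℝ) ≤ Fintype.card κ := by exact_mod_cast hκ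
      linarith
  · refine (AEMeasurable.exp (AEMeasurable.mul ?_ ?_)).ennreal_ofReal
    · exact measurable_snd.neg.aemeasurable
    · exact Finset.aemeasurable_fun_sum _ fun k _ => ((hm k).comp_fst).pow_const 2

end GaussianFamily

/-! ### Distance from a vector to a span. -/

section SqDistSpan

variable {ι κ : Type*} [Fintype κ]

variable [Fintype ι] in
/-- The squared Euclidean distance of `x` to the span of the vectors `v j`. -/
noncomputable def sqDistSpan (x : ι → ℝ) (v : κ → ι → ℝ) : ENNReal :=
  ⨅ c : κ → ℝ, ENNReal.ofReal (∑ l, (x l - ∑ j, c j * v j l) ^ 2)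

-- An infimum of continuous functions is upper semicontinuous, hence Borel measurable even though
-- the family is uncountable.
variable [Fintype ι] in
theorem measurable_sqDistSpan :
    Measurable fun z : (ι → ℝ) × (κ → ι → ℝ) => sqDistSpan z.1 z.2 := by
  refine (upperSemicontinuous_iInf fun c => ?_ : UpperSemicontinuous _).measurable
  exact (ENNReal.continuous_ofReal.comp (by fun_prop)).upperSemicontinuous

/-- The span of a finite family of coordinate vectors, in Euclidean space. -/
noncomputable def euclideanSpan (v : κ → ι → ℝ) : Submodule ℝ (EuclideanSpace ℝ ι) :=
  Submodule.span ℝ (Set.range fun j => WithLp.toLp 2 (v j))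

theorem finrank_euclideanSpan_le (v : κ → ι → ℝ) :
    Module.finrank ℝ (euclideanSpan v) ≤ Fintype.card κ :=
  finrank_range_le_card _

theorem finrank_euclideanSpan_eq {v : κ → ι → ℝ} (hv : LinearIndependent ℝ v) :
    Module.finrank ℝ (euclideanSpan v) = Fintype.card κ :=
  finrank_span_eq_card (hv.map' (WithLp.linearEquiv 2 ℝ (ι → ℝ)).symm.toLinearMap
    (LinearEquiv.ker _))

variable [Fintype ι] in
/-- The squared distance to a span is the sum of the squared coordinates along an orthonormal
basis of the orthogonal complement. -/
theorem exists_sqDistSpan_eq (v : κ → ι → ℝ) :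
    ∃ M : Matrix (Fin (Module.finrank ℝ (euclideanSpan v)ᗮ)) ι ℝ, M * Mᵀ = 1 ∧
      ∀ x, sqDistSpan x v = ENNReal.ofReal (∑ l, (∑ i, M l i * x i) ^ 2) := by
  set W := euclideanSpan v with hW
  let e := stdOrthonormalBasis ℝ Wᗮ
  have hinner : ∀ (l) (y : EuclideanSpace ℝ ι),
      inner ℝ (e l : EuclideanSpace ℝ ι) y = ∑ i, (e l : EuclideanSpace ℝ ι) i * y i := by
    intro l y
    simp [PiLp.inner_apply, mul_comm]
  have hproj : ∀ y : EuclideanSpace ℝ ι, ‖Wᗮ.starProjection y‖ ^ 2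
      = ∑ l, (∑ i, (e l : EuclideanSpace ℝ ι) i * y i) ^ 2 := by
    intro y
    have h := e.sum_sq_norm_inner_right (Wᗮ.orthogonalProjectionOnto y)
    rw [Submodule.starProjection_apply, ← Submodule.coe_norm, ← h]
    refine Finset.sum_congr rfl fun l _ => ?_
    rw [Submodule.inner_orthogonalProjectionOnto_eq_of_mem_left, hinner, Real.norm_eq_abs, sq_abs]
  have hcomb : ∀ c : κ → ℝ, (∑ j, c j • WithLp.toLp 2 (v j)) ∈ W := fun c =>
    Submodule.sum_mem _ fun j _ => Submodule.smul_mem _ _ (Submodule.subset_span ⟨j, rfl⟩)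
  have hnorm : ∀ (x : ι → ℝ) (c : κ → ℝ), ∑ l, (x l - ∑ j, c j * v j l) ^ 2
      = ‖WithLp.toLp 2 x - ∑ j, c j • WithLp.toLp 2 (v j)‖ ^ 2 := by
    intro x c
    rw [EuclideanSpace.norm_sq_eq]
    simp
  have hperp : ∀ (y w : EuclideanSpace ℝ ι), w ∈ W →
      Wᗮ.starProjection (y - w) = Wᗮ.starProjection y := by
    intro y w hw
    rw [map_sub, (Submodule.starProjection_apply_eq_zero_iff _).2
      (W.le_orthogonal_orthogonal hw), sub_zero]
  refine ⟨Matrix.of fun l i => (e l : EuclideanSpace ℝ ι) i, ?_, fun x => ?_⟩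
  · ext l l'
    rw [Matrix.mul_apply, Matrix.one_apply]
    have h := orthonormal_iff_ite.1 e.orthonormal l l'
    rw [Submodule.coe_inner, hinner] at h
    exact h
  · simp only [Matrix.of_apply]
    rw [← hproj (WithLp.toLp 2 x)]
    apply le_antisymm
    -- The coefficients of the orthogonal projection onto `W` attain the infimum.
    · have hmem : W.starProjection (WithLp.toLp 2 x) ∈ W := Submodule.starProjection_apply_mem _ _
      obtain ⟨c, hc⟩ := (Submodule.mem_span_range_iff_exists_fun ℝ).1 hmem
      refine (iInf_le _ c).trans (le_of_eq ?_)
      rw [hnorm, hc, Submodule.starProjection_orthogonal_val]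
    -- Subtracting a vector of `W` does not change the component in `Wᗮ`, and projecting onto `Wᗮ`
    -- shortens.
    · refine le_iInf fun c => ENNReal.ofReal_le_ofReal ?_
      rw [hnorm, ← hperp _ _ (hcomb c)]
      gcongr
      exact Submodule.norm_starProjection_apply_le _ _

end SqDistSpan

/-- The coordinates of `X` along an orthonormal basis of the complement are again independent `N(0,
α)`. The value involves the rank of `v`, not its cardinality, because `v` may be dependent; `hκ`
leaves a complement of dimension at least 3. -/
theorem IsGaussianFamily.lintegral_inv_sqDistSpan {Ω ι κ : Type*} [MeasurableSpace Ω]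
    {P : Measure Ω} {α : ℝ≥0} [Fintype ι] [Fintype κ] {X : ι → Ω → ℝ}
    (hX : IsGaussianFamily P α X) (hα : 0 < α) (hκ : Fintype.card κ + 3 ≤ Fintype.card ι)
    (v : κ → ι → ℝ) :
    ∫⁻ ω, (sqDistSpan (fun l => X l ω) v)⁻¹ ∂P = ENNReal.ofReal
      (1 / (α * ((Fintype.card ι : ℝ) - Module.finrank ℝ (euclideanSpan v) - 2))) := by
  obtain ⟨M, hM, hD⟩ := exists_sqDistSpan_eq v
  have hd := finrank_euclideanSpan_le v
  have hsum := (euclideanSpan v).finrank_add_finrank_orthogonal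
  rw [finrank_euclideanSpace] at hsum
  simp_rw [hD]
  rw [(hX.orthonormal_comb M hM).lintegral_inv_sum_sq hα (by rw [Fintype.card_fin]; omega),
    Fintype.card_fin, ← hsum]
  push_cast
  congr 3
  ring

/-- Column `i` of `Gᵀ * C` lies in the row space, is orthogonal to every row but row `i`, and has
inner product 1 with row `i`. It is therefore the component of row `i` normal to the other rows,
divided by the squared length of that component. -/
theorem ofReal_sum_sq_col_eq_inv_sqDistSpan {a b : Type*} [Fintype a] [Fintype b] [DecidableEq a]
    (G : Matrix a b ℝ) (C : Matrix a a ℝ) (hC : G * (Gᵀ * C) = 1) (i : a) :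
    ENNReal.ofReal (∑ l, (Gᵀ * C) l i ^ 2)
      = (sqDistSpan (G i) fun j : {j // j ≠ i} => G j)⁻¹ := by
  set B := Gᵀ * C with hB
  have hGB : ∀ j, ∑ l, G j l * B l i = if j = i then 1 else 0 := by
    intro j
    rw [← Matrix.mul_apply, hC, Matrix.one_apply]
  have hBl : ∀ l, B l i = ∑ j, C j i * G j l := by
    intro l
    rw [hB, Matrix.mul_apply]
    simp [mul_comm]
  have hsq : ∑ l, B l i ^ 2 = C i i := by
    calc ∑ l, B l i ^ 2 = ∑ l, ∑ j, C j i * (G j l * B l i) := by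
          refine Finset.sum_congr rfl fun l _ => ?_
          rw [sq]
          conv_lhs => enter [1]; rw [hBl l]
          rw [Finset.sum_mul]
          simp [mul_assoc]
      _ = ∑ j, C j i * ∑ l, G j l * B l i := by
          rw [Finset.sum_comm]
          simp [Finset.mul_sum]
      _ = C i i := by simp [hGB]
  have hsplit : ∀ f : a → ℝ, ∑ j, f j = f i + ∑ j : {j // j ≠ i}, f j := by
    intro f
    rw [Fintype.sum_eq_add_sum_subtype_ne f i]
  have hpos : 0 < ∑ l, B l i ^ 2 := by
    refine (Finset.sum_nonneg fun l _ => sq_nonneg _).lt_of_ne fun h => ?_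
    have h0 : ∀ l, B l i = 0 := by
      intro l
      have := (Finset.sum_eq_zero_iff_of_nonneg fun l _ => sq_nonneg (B l i)).1 h.symm l
        (Finset.mem_univ l)
      simpa using this
    simpa [h0] using hGB i
  rw [← inv_inv (ENNReal.ofReal _), ← ENNReal.ofReal_inv_of_pos hpos]
  congr 1
  apply le_antisymm
  -- Any difference of row `i` and a combination of the others has inner product 1 with column `i`;
  -- Cauchy–Schwarz bounds its length below.
  · refine le_iInf fun c => ENNReal.ofReal_le_ofReal ?_
    have h1 : ∑ l, (G i l - ∑ j : {j // j ≠ i}, c j * G j l) * B l i = 1 := by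
      simp_rw [sub_mul, Finset.sum_sub_distrib, Finset.sum_mul]
      rw [Finset.sum_comm, hGB]
      simp_rw [mul_assoc, ← Finset.mul_sum, hGB]
      simp [fun j : {j // j ≠ i} => j.2]
    have h2 := Finset.sum_mul_sq_le_sq_mul_sq Finset.univ
      (fun l => G i l - ∑ j : {j // j ≠ i}, c j * G j l) (fun l => B l i)
    rw [h1, one_pow] at h2
    rwa [inv_le_iff_one_le_mul₀ hpos]
  -- Dividing `B l i = ∑ j, C j i * G j l` by `C i i`, the squared norm of column `i`, gives
  -- coefficient 1 to row `i`; the remaining coefficients, negated, are the minimizer.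
  · refine (iInf_le _ fun j : {j // j ≠ i} => -(C j i / C i i)).trans (le_of_eq ?_)
    rw [hsq] at hpos ⊢
    congr 1
    have h3 : ∀ l, G i l - ∑ j : {j // j ≠ i}, -(C j i / C i i) * G j l = B l i / C i i := by
      intro l
      rw [hBl, hsplit, add_div, Finset.sum_div, mul_div_cancel_left₀ _ hpos.ne',
        sub_eq_add_neg, ← Finset.sum_neg_distrib]
      congr 1
      refine Finset.sum_congr rfl fun j _ => ?_
      ring
    simp_rw [h3, div_pow]
    rw [← Finset.sum_div, hsq]
    field_simp

theorem notMem_span_of_sqDistSpan_ne_zero {ι κ : Type*} [Fintype ι] [Fintype κ] {x : ι → ℝ}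
    {v : κ → ι → ℝ} (h : sqDistSpan x v ≠ 0) : x ∉ Submodule.span ℝ (Set.range v) := by
  intro hx
  obtain ⟨c, rfl⟩ := (Submodule.mem_span_range_iff_exists_fun ℝ).1 hx
  refine h (le_antisymm ((iInf_le _ c).trans (le_of_eq ?_)) zero_le)
  simp

theorem linearIndependent_of_sqDistSpan_ne_zero {a b : Type*} [Fintype a] [Fintype b]
    [DecidableEq a] {v : a → b → ℝ}
    (h : ∀ i, sqDistSpan (v i) (fun j : {j // j ≠ i} => v j) ≠ 0) : LinearIndependent ℝ v := by
  refine linearIndependent_iff_notMem_span.2 fun i hi => ?_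
  refine notMem_span_of_sqDistSpan_ne_zero (h i) ?_
  have : v '' (Set.univ \ {i}) = Set.range fun j : {j // j ≠ i} => v j := by
    ext y
    simp
  rwa [← this]

/-! ### The pseudo-inverse at full row rank. -/

section FullRank

variable {a b : Type*} [Fintype a] [Fintype b] [DecidableEq a]

theorem isUnit_self_mul_transpose {G : Matrix a b ℝ} (h : LinearIndependent ℝ G.row) :
    IsUnit (G * Gᵀ) := by
  rw [← Matrix.vecMul_injective_iff_isUnit]
  have hinj := Matrix.vecMul_injective_iff.2 h
  intro x y hxy
  have h0 : (x - y) ᵥ* (G * Gᴴ) = 0 := by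
    rw [Matrix.conjTranspose_eq_transpose_of_trivial, Matrix.sub_vecMul]
    exact sub_eq_zero.2 hxy
  rw [Matrix.vecMul_self_mul_conjTranspose_eq_zero, Matrix.sub_vecMul, sub_eq_zero] at h0
  exact hinj h0

theorem mul_transpose_mul_inv {G : Matrix a b ℝ} (h : LinearIndependent ℝ G.row) :
    G * (Gᵀ * (G * Gᵀ)⁻¹) = 1 := by
  rw [← Matrix.mul_assoc,
    Matrix.mul_nonsing_inv _ ((Matrix.isUnit_iff_isUnit_det _).1 (isUnit_self_mul_transpose h))]

theorem pinv_eq_of_linearIndependent {G : Matrix a b ℝ} (h : LinearIndependent ℝ G.row) :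
    pinv G = Gᵀ * (G * Gᵀ)⁻¹ := by
  have h1 := mul_transpose_mul_inv h
  refine (isMoorePenrose_pinv G).unique ⟨?_, ?_, ?_, ?_⟩
  · rw [h1, Matrix.one_mul]
  · rw [Matrix.mul_assoc _ G, h1, Matrix.mul_one]
  · rw [h1, Matrix.transpose_one]
  · simp [Matrix.transpose_mul, Matrix.transpose_nonsing_inv, Matrix.mul_assoc]

/-- `pinv` is defined by choice, so its measurability comes from the full-rank formula: determinants
and adjugates are polynomials in the entries. -/
theorem measurable_transpose_mul_inv (l : b) (i : a) :
    Measurable fun z : a × b → ℝ => ((Matrix.of fun i l => z (i, l))ᵀ *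
      ((Matrix.of fun i l => z (i, l)) * (Matrix.of fun i l => z (i, l))ᵀ)⁻¹) l i := by
  have hdet : ∀ M : (a × b → ℝ) → Matrix a a ℝ, (∀ j j', Measurable fun z => M z j j') →
      Measurable fun z => (M z).det := by
    intro M hM
    simp_rw [Matrix.det_apply]
    exact Finset.measurable_fun_sum _ fun σ _ =>
      (Finset.measurable_fun_prod _ fun j _ => hM _ _).const_smul _
  have hprod : ∀ j j', Measurable fun z : a × b → ℝ =>
      ((Matrix.of fun i l => z (i, l)) * (Matrix.of fun i l => z (i, l))ᵀ) j j' := by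
    intro j j'
    simp only [Matrix.mul_apply, Matrix.transpose_apply, Matrix.of_apply]
    fun_prop
  have hadj : ∀ j j', Measurable fun z : a × b → ℝ =>
      ((Matrix.of fun i l => z (i, l)) * (Matrix.of fun i l => z (i, l))ᵀ).adjugate j j' := by
    intro j j'
    simp_rw [Matrix.adjugate_apply]
    refine hdet _ fun s t => ?_
    simp_rw [Matrix.updateRow_apply]
    split_ifs
    · exact measurable_const
    · exact hprod s t
  simp_rw [Matrix.mul_apply (M := Matrix.transpose _), Matrix.inv_def, Matrix.smul_apply,
    Ring.inverse_eq_inv', smul_eq_mul]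
  exact Finset.measurable_fun_sum _ fun j _ => (measurable_pi_apply (j, l)).mul
    ((hdet _ hprod).inv.mul (hadj j i))

end FullRank

/-! ### Independence of disjoint blocks, and integration with one block frozen. -/

theorem IsGaussianFamily.indepFun_of_disjoint {Ω ι κ κ' : Type*} [MeasurableSpace Ω]
    {P : Measure Ω} {α : ℝ≥0} [Finite ι] {X : ι → Ω → ℝ} (hX : IsGaussianFamily P α X)
    (g : κ → ι) (h : κ' → ι) (hgh : ∀ k k', g k ≠ h k') :
    IndepFun (fun ω k => X (g k) ω) (fun ω k => X (h k) ω) P := by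
  classical
  have := Fintype.ofFinite ι
  let S : Finset ι := Finset.univ.filter (· ∈ Set.range g)
  let T : Finset ι := Finset.univ.filter (· ∈ Set.range h)
  have hST : Disjoint S T := by
    rw [Finset.disjoint_left]
    intro i hi hi'
    obtain ⟨k, rfl⟩ := (Finset.mem_filter.1 hi).2
    obtain ⟨k', hk'⟩ := (Finset.mem_filter.1 hi').2
    exact hgh k k' hk'.symm
  exact (hX.indep.indepFun_finset₀ S T hST fun i => (hX.hasLaw i).aemeasurable).comp
    (φ := fun z k => z ⟨g k, Finset.mem_filter.2 ⟨Finset.mem_univ _, k, rfl⟩⟩)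
    (ψ := fun z k => z ⟨h k, Finset.mem_filter.2 ⟨Finset.mem_univ _, k, rfl⟩⟩)
    (by fun_prop) (by fun_prop)

theorem ProbabilityTheory.IndepFun.lintegral_comp_prodMk {Ω E F : Type*} [MeasurableSpace Ω]
    [MeasurableSpace E] [MeasurableSpace F] {P : Measure Ω} [IsFiniteMeasure P] {X : Ω → E}
    {Y : Ω → F} (hXY : IndepFun X Y P) (hX : AEMeasurable X P) (hY : AEMeasurable Y P)
    {f : E × F → ENNReal} (hf : Measurable f) :
    ∫⁻ ω, f (X ω, Y ω) ∂P = ∫⁻ ω, ∫⁻ ω', f (X ω', Y ω) ∂P ∂P := by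
  have h : ∀ y, ∫⁻ x, f (x, y) ∂(P.map X) = ∫⁻ ω', f (X ω', y) ∂P := fun y =>
    lintegral_map' (hf.comp measurable_prodMk_right).aemeasurable hX
  rw [← lintegral_map' hf.aemeasurable (hX.prodMk hY),
    (indepFun_iff_map_prod_eq_prod_map_map hX hY).1 hXY, lintegral_prod_symm _ hf.aemeasurable,
    lintegral_map' hf.lintegral_prod_left'.aemeasurable hY]
  simp_rw [h]

/-! ### Almost sure full rank and moments of the pseudo-inverse. -/

namespace IsGaussianMatrix

variable {Ω : Type*} [MeasurableSpace Ω] {P : Measure Ω} [IsProbabilityMeasure P] {α : ℝ≥0}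
  {a b : Type*} [Fintype a] [Fintype b] [DecidableEq a] {G : Ω → Matrix a b ℝ}

omit [IsProbabilityMeasure P] [Fintype a] [Fintype b] [DecidableEq a] in
theorem aemeasurable (hG : IsGaussianMatrix P α G) (i : a) (j : b) :
    AEMeasurable (fun ω => G ω i j) P :=
  (hG.hasLaw i j).aemeasurable

omit [IsProbabilityMeasure P] in
theorem aemeasurable_sqDistSpan (hG : IsGaussianMatrix P α G) (i : a) :
    AEMeasurable (fun ω => sqDistSpan (G ω i) fun j : {j // j ≠ i} => G ω j) P :=
  measurable_sqDistSpan.comp_aemeasurable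
    (f := fun ω => (G ω i, fun j : {j // j ≠ i} => G ω j))
    ((aemeasurable_pi_lambda _ fun l => hG.aemeasurable i l).prodMk
      (aemeasurable_pi_lambda _ fun j => aemeasurable_pi_lambda _ fun l => hG.aemeasurable j l))

/-- Row `i` is integrated out with the other rows frozen. Their rank stays random here: full rank is
deduced from this very identity. -/
theorem lintegral_inv_sqDistSpan (hG : IsGaussianMatrix P α G) (hα : 0 < α)
    (hab : Fintype.card a + 2 ≤ Fintype.card b) (i : a) :
    ∫⁻ ω, (sqDistSpan (G ω i) fun j : {j // j ≠ i} => G ω j)⁻¹ ∂P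
      = ∫⁻ ω, ENNReal.ofReal (1 / (α * ((Fintype.card b : ℝ) -
          Module.finrank ℝ (euclideanSpan fun j : {j // j ≠ i} => G ω j) - 2))) ∂P := by
  have hX := hG.family
  have hrow := hX.precomp (g := fun l : b => (i, l)) fun l l' h => (Prod.ext_iff.1 h).2
  have hind : IndepFun (fun ω => G ω i) (fun ω (j : {j // j ≠ i}) => G ω j) P := by
    refine (hX.indepFun_of_disjoint (fun l : b => (i, l))
      (fun z : {j // j ≠ i} × b => ((z.1 : a), z.2))
      fun l z h => z.1.2 (Prod.ext_iff.1 h).1.symm).comp (φ := id)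
      (ψ := fun z j l => z (j, l)) measurable_id (by fun_prop)
  have hm1 : AEMeasurable (fun ω => G ω i) P :=
    aemeasurable_pi_lambda _ fun l => hG.aemeasurable i l
  have hm2 : AEMeasurable (fun ω (j : {j // j ≠ i}) => G ω j) P :=
    aemeasurable_pi_lambda _ fun j => aemeasurable_pi_lambda _ fun l => hG.aemeasurable j l
  have hcard : Fintype.card {j // j ≠ i} + 3 ≤ Fintype.card b := by
    have : 0 < Fintype.card a := Fintype.card_pos_iff.2 ⟨i⟩
    simp only [Fintype.card_subtype_compl, Fintype.card_unique]
    omega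
  refine (hind.lintegral_comp_prodMk hm1 hm2 measurable_sqDistSpan.inv).trans ?_
  exact lintegral_congr fun ω => hrow.lintegral_inv_sqDistSpan hα hcard _

/-- A Gaussian matrix with at least two more columns than rows has full row rank. -/
theorem ae_linearIndependent (hG : IsGaussianMatrix P α G) (hα : 0 < α)
    (hab : Fintype.card a + 2 ≤ Fintype.card b) :
    ∀ᵐ ω ∂P, LinearIndependent ℝ (G ω).row := by
  have h : ∀ i, ∀ᵐ ω ∂P, sqDistSpan (G ω i) (fun j : {j // j ≠ i} => G ω j) ≠ 0 := by
    intro i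
    have hfin : ∫⁻ ω, (sqDistSpan (G ω i) fun j : {j // j ≠ i} => G ω j)⁻¹ ∂P ≠ ⊤ := by
      rw [hG.lintegral_inv_sqDistSpan hα hab i]
      -- The other rows span at most `card a - 1` dimensions, so the factor multiplying `α` in the
      -- denominator is at least 1 and `1 / α` bounds the integrand.
      refine ne_top_of_le_ne_top (ENNReal.ofReal_ne_top (r := 1 / α))
        ((lintegral_mono fun ω => ENNReal.ofReal_le_ofReal
          (?_ : _ ≤ 1 / (α : ℝ))).trans (by simp))
      have hα' : (0 : ℝ) < α := hα
      refine one_div_le_one_div_of_le hα' (le_mul_of_one_le_right hα'.le ?_)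
      have h1 := finrank_euclideanSpan_le fun j : {j // j ≠ i} => G ω j
      have : 0 < Fintype.card a := Fintype.card_pos_iff.2 ⟨i⟩
      simp only [Fintype.card_subtype_compl, Fintype.card_unique] at h1
      have h2 : Module.finrank ℝ (euclideanSpan fun j : {j // j ≠ i} => G ω j) + 3
          ≤ Fintype.card b := by omega
      have h3 : (Module.finrank ℝ (euclideanSpan fun j : {j // j ≠ i} => G ω j) : ℝ) + 3
          ≤ Fintype.card b := by exact_mod_cast h2
      linarith
    -- The inverse is `⊤` where the distance vanishes, so a finite mean excludes this almost surely.
    filter_upwards [ae_lt_top' (hG.aemeasurable_sqDistSpan i).inv hfin] with ω hω h0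
    simp [h0] at hω
  filter_upwards [ae_all_iff.2 h] with ω hω
  exact linearIndependent_of_sqDistSpan_ne_zero hω

theorem ae_mul_pinv (hG : IsGaussianMatrix P α G) (hα : 0 < α)
    (hab : Fintype.card a + 2 ≤ Fintype.card b) : ∀ᵐ ω ∂P, G ω * pinv (G ω) = 1 := by
  filter_upwards [hG.ae_linearIndependent hα hab] with ω hω
  rw [pinv_eq_of_linearIndependent hω, mul_transpose_mul_inv hω]

theorem lintegral_pinv_col_sq (hG : IsGaussianMatrix P α G) (hα : 0 < α)
    (hab : Fintype.card a + 2 ≤ Fintype.card b) (i : a) :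
    ∫⁻ ω, ENNReal.ofReal (∑ l, pinv (G ω) l i ^ 2) ∂P
      = ENNReal.ofReal (1 / (α * ((Fintype.card b : ℝ) - Fintype.card a - 1))) := by
  have hli := hG.ae_linearIndependent hα hab
  calc _ = ∫⁻ ω, (sqDistSpan (G ω i) fun j : {j // j ≠ i} => G ω j)⁻¹ ∂P := by
        refine lintegral_congr_ae ?_
        filter_upwards [hli] with ω hω
        rw [pinv_eq_of_linearIndependent hω]
        exact ofReal_sum_sq_col_eq_inv_sqDistSpan _ _ (mul_transpose_mul_inv hω) i
    _ = ∫⁻ ω, ENNReal.ofReal (1 / (α * ((Fintype.card b : ℝ) - Fintype.card a - 1))) ∂P := by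
        rw [hG.lintegral_inv_sqDistSpan hα hab i]
        refine lintegral_congr_ae ?_
        filter_upwards [hli] with ω hω
        have : 0 < Fintype.card a := Fintype.card_pos_iff.2 ⟨i⟩
        -- Full rank turns the random rank into the constant `card a - 1`.
        have hfin : Module.finrank ℝ (euclideanSpan fun j : {j // j ≠ i} => G ω j)
            = Fintype.card {j // j ≠ i} := finrank_euclideanSpan_eq
          (hω.comp (fun j : {j // j ≠ i} => (j : a)) Subtype.val_injective)
        rw [hfin]
        simp only [Fintype.card_subtype_compl, Fintype.card_unique]
        rw [Nat.cast_sub this]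
        push_cast
        congr 3
        ring
    _ = _ := by simp

theorem aemeasurable_pinv (hG : IsGaussianMatrix P α G) (hα : 0 < α)
    (hab : Fintype.card a + 2 ≤ Fintype.card b) (l : b) (i : a) :
    AEMeasurable (fun ω => pinv (G ω) l i) P := by
  have h : AEMeasurable (entries G) P := aemeasurable_pi_lambda _ fun z => hG.aemeasurable z.1 z.2
  refine ((measurable_transpose_mul_inv l i).comp_aemeasurable h).congr ?_
  filter_upwards [hG.ae_linearIndependent hα hab] with ω hω
  rw [pinv_eq_of_linearIndependent hω]
  rfl

theorem integrable_pinv_col_sq (hG : IsGaussianMatrix P α G) (hα : 0 < α)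
    (hab : Fintype.card a + 2 ≤ Fintype.card b) (i : a) :
    Integrable (fun ω => ∑ l, pinv (G ω) l i ^ 2) P := by
  refine ⟨(Finset.aemeasurable_fun_sum _ fun l _ =>
    (hG.aemeasurable_pinv hα hab l i).pow_const 2).aestronglyMeasurable, ?_⟩
  rw [hasFiniteIntegral_iff_ofReal
    (ae_of_all _ fun ω => Finset.sum_nonneg fun l _ => sq_nonneg _),
    hG.lintegral_pinv_col_sq hα hab]
  exact ENNReal.ofReal_lt_top

theorem integral_pinv_col_sq (hG : IsGaussianMatrix P α G) (hα : 0 < α)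
    (hab : Fintype.card a + 2 ≤ Fintype.card b) (i : a) :
    ∫ ω, ∑ l, pinv (G ω) l i ^ 2 ∂P
      = 1 / (α * ((Fintype.card b : ℝ) - Fintype.card a - 1)) := by
  rw [integral_eq_lintegral_of_nonneg_ae
    (ae_of_all _ fun ω => Finset.sum_nonneg fun l _ => sq_nonneg _)
    (hG.integrable_pinv_col_sq hα hab i).aestronglyMeasurable,
    hG.lintegral_pinv_col_sq hα hab, ENNReal.toReal_ofReal]
  have : (Fintype.card a : ℝ) + 2 ≤ Fintype.card b := by exact_mod_cast hab
  have h1 : (0 : ℝ) ≤ (Fintype.card b : ℝ) - Fintype.card a - 1 := by linarith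
  positivity

theorem memLp_pinv (hG : IsGaussianMatrix P α G) (hα : 0 < α)
    (hab : Fintype.card a + 2 ≤ Fintype.card b) (l : b) (i : a) :
    MemLp (fun ω => pinv (G ω) l i) 2 P := by
  have hm := (hG.aemeasurable_pinv hα hab l i).aestronglyMeasurable
  rw [memLp_two_iff_integrable_sq hm]
  refine (hG.integrable_pinv_col_sq hα hab i).mono' (hm.pow 2) (ae_of_all _ fun ω => ?_)
  rw [Real.norm_eq_abs, abs_of_nonneg (sq_nonneg _)]
  exact Finset.single_le_sum (f := fun l => pinv (G ω) l i ^ 2)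
    (fun l _ => sq_nonneg _) (Finset.mem_univ l)

end IsGaussianMatrix

/-! ### Second moment of `S G₂ G₁†`. -/

theorem Matrix.frobenius_norm_sq {a b : Type*} [Fintype a] [Fintype b] (M : Matrix a b ℝ) :
    ‖M‖ ^ 2 = ∑ i, ∑ j, M i j ^ 2 := by
  rw [Matrix.frobenius_norm_def, ← Real.sqrt_eq_rpow, Real.sq_sqrt]
  · simp
  · exact Finset.sum_nonneg fun i _ => Finset.sum_nonneg fun j _ => by positivity

namespace IsGaussianMatrix

variable {Ω : Type*} [MeasurableSpace Ω] {P : Measure Ω} [IsProbabilityMeasure P] {α : ℝ≥0}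
  {a b q r : Type*} [Fintype a] [Fintype b] [Fintype q] [Fintype r] [DecidableEq a]
  {G₁ : Ω → Matrix a b ℝ} {G₂ : Ω → Matrix r b ℝ}

omit [Fintype r] in
theorem indepFun_mul_pinv (h₁ : IsGaussianMatrix P α G₁)
    (hind : IndepFun (entries G₁) (entries G₂) P) (hα : 0 < α)
    (hab : Fintype.card a + 2 ≤ Fintype.card b) (z z' : r × b) (i : a) :
    IndepFun (fun ω => entries G₂ ω z * entries G₂ ω z')
      (fun ω => pinv (G₁ ω) z.2 i * pinv (G₁ ω) z'.2 i) P := by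
  refine (hind.symm.comp (φ := fun x => x z * x z') (by fun_prop)
    ((measurable_transpose_mul_inv z.2 i).mul (measurable_transpose_mul_inv z'.2 i))).congr
    .rfl ?_
  filter_upwards [h₁.ae_linearIndependent hα hab] with ω hω
  rw [pinv_eq_of_linearIndependent hω]
  rfl

/-- The second moment of `S G₂ G₁†` for independent Gaussian matrices `G₁`, `G₂`. -/
theorem integral_norm_sq_mul_pinv (h₁ : IsGaussianMatrix P α G₁) (h₂ : IsGaussianMatrix P α G₂)
    (hind : IndepFun (entries G₁) (entries G₂) P) (hα : 0 < α)
    (hab : Fintype.card a + 2 ≤ Fintype.card b) (S : Matrix q r ℝ) :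
    Integrable (fun ω => ‖S * G₂ ω * pinv (G₁ ω)‖ ^ 2) P ∧
    ∫ ω, ‖S * G₂ ω * pinv (G₁ ω)‖ ^ 2 ∂P
      = Fintype.card a / ((Fintype.card b : ℝ) - Fintype.card a - 1) * ‖S‖ ^ 2 := by
  classical
  -- The square is expanded so that each term is a product of entries of `G₂` times an independent
  -- product of entries of `G₁†`; only the terms `z = z'` have nonzero mean.
  have hexp : ∀ ω, ‖S * G₂ ω * pinv (G₁ ω)‖ ^ 2
      = ∑ s, ∑ i, ∑ z : r × b, ∑ z' : r × b, (S s z.1 * S s z'.1) *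
        ((entries G₂ ω z * entries G₂ ω z') * (pinv (G₁ ω) z.2 i * pinv (G₁ ω) z'.2 i)) := by
    intro ω
    rw [Matrix.frobenius_norm_sq]
    refine Finset.sum_congr rfl fun s _ => Finset.sum_congr rfl fun i _ => ?_
    have : (S * G₂ ω * pinv (G₁ ω)) s i
        = ∑ z : r × b, S s z.1 * entries G₂ ω z * pinv (G₁ ω) z.2 i := by
      rw [Matrix.mul_apply, Fintype.sum_prod_type, Finset.sum_comm]
      simp_rw [Matrix.mul_apply, Finset.sum_mul]
      rfl
    rw [this, sq, Finset.sum_mul_sum]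
    refine Finset.sum_congr rfl fun z _ => Finset.sum_congr rfl fun z' _ => ?_
    ring
  have hGG : ∀ z z', Integrable (fun ω => entries G₂ ω z * entries G₂ ω z') P := fun z z' =>
    (h₂.family.memLp_two z).integrable_mul (h₂.family.memLp_two z')
  have hBB : ∀ l l' i, Integrable (fun ω => pinv (G₁ ω) l i * pinv (G₁ ω) l' i) P := fun l l' i =>
    (h₁.memLp_pinv hα hab l i).integrable_mul (h₁.memLp_pinv hα hab l' i)
  have hterm : ∀ s i (z z' : r × b), Integrable (fun ω => (S s z.1 * S s z'.1) *
      ((entries G₂ ω z * entries G₂ ω z') * (pinv (G₁ ω) z.2 i * pinv (G₁ ω) z'.2 i))) P :=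
    fun s i z z' => ((h₁.indepFun_mul_pinv hind hα hab z z' i).integrable_mul
      (hGG z z') (hBB z.2 z'.2 i)).const_mul _
  have hval : ∀ s i (z z' : r × b), ∫ ω, (S s z.1 * S s z'.1) *
      ((entries G₂ ω z * entries G₂ ω z') * (pinv (G₁ ω) z.2 i * pinv (G₁ ω) z'.2 i)) ∂P
      = if z = z' then α * (S s z.1 ^ 2 * ∫ ω, pinv (G₁ ω) z.2 i ^ 2 ∂P) else 0 := by
    intro s i z z'
    rw [integral_const_mul,
      (h₁.indepFun_mul_pinv hind hα hab z z' i).integral_fun_mul_eq_mul_integral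
      (hGG z z').aestronglyMeasurable (hBB z.2 z'.2 i).aestronglyMeasurable,
      h₂.family.integral_mul_eq z z']
    split_ifs with h
    · subst h
      simp_rw [← sq]
      ring
    · simp
  simp_rw [hexp]
  refine ⟨integrable_finsetSum _ fun s _ => integrable_finsetSum _ fun i _ =>
    integrable_finsetSum _ fun z _ => integrable_finsetSum _ fun z' _ => hterm s i z z', ?_⟩
  rw [integral_finsetSum _ fun s _ => integrable_finsetSum _ fun i _ =>
    integrable_finsetSum _ fun z _ => integrable_finsetSum _ fun z' _ => hterm s i z z']
  have hs : ∀ s, ∫ ω, ∑ i, ∑ z : r × b, ∑ z' : r × b, (S s z.1 * S s z'.1) *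
      ((entries G₂ ω z * entries G₂ ω z') * (pinv (G₁ ω) z.2 i * pinv (G₁ ω) z'.2 i)) ∂P
      = Fintype.card a / ((Fintype.card b : ℝ) - Fintype.card a - 1) * ∑ j, S s j ^ 2 := by
    intro s
    rw [integral_finsetSum _ fun i _ =>
      integrable_finsetSum _ fun z _ => integrable_finsetSum _ fun z' _ => hterm s i z z']
    have hi : ∀ i, ∫ ω, ∑ z : r × b, ∑ z' : r × b, (S s z.1 * S s z'.1) *
        ((entries G₂ ω z * entries G₂ ω z') * (pinv (G₁ ω) z.2 i * pinv (G₁ ω) z'.2 i)) ∂P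
        = 1 / ((Fintype.card b : ℝ) - Fintype.card a - 1) * ∑ j, S s j ^ 2 := by
      intro i
      have hcol := h₁.integral_pinv_col_sq hα hab i
      rw [integral_finsetSum _ fun l _ => (h₁.memLp_pinv hα hab l i).integrable_sq] at hcol
      rw [integral_finsetSum _ fun z _ => integrable_finsetSum _ fun z' _ => hterm s i z z']
      simp_rw [integral_finsetSum _ fun z' _ => hterm s i _ z', hval]
      simp only [Finset.sum_ite_eq, Finset.mem_univ, if_true]
      simp_rw [← Finset.mul_sum, Fintype.sum_prod_type, ← Finset.mul_sum, hcol, ← Finset.sum_mul]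
      -- The variance `α` of the entries of `G₂` cancels the `1 / α` from `hcol`.
      have : (0 : ℝ) < α := hα
      rw [one_div, mul_inv]
      field_simp
    simp_rw [hi, Finset.sum_const, Finset.card_univ, nsmul_eq_mul]
    ring
  simp_rw [hs, ← Finset.mul_sum, ← Matrix.frobenius_norm_sq]

end IsGaussianMatrix

/-! ### Deterministic error bound for the projection. -/

section Projection

variable {m n r b c d : Type*} [Fintype m] [Fintype n] [Fintype r] [Fintype b] [Fintype c]
  [Fintype d]

theorem Matrix.frobenius_norm_sq_eq_trace_mul_transpose (M : Matrix m n ℝ) :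
    ‖M‖ ^ 2 = (M * Mᵀ).trace := by
  rw [Matrix.frobenius_norm_sq, Matrix.trace]
  simp [Matrix.mul_apply, sq]

theorem Matrix.frobenius_norm_sq_eq_trace_transpose_mul (M : Matrix m n ℝ) :
    ‖M‖ ^ 2 = (Mᵀ * M).trace := by
  rw [Matrix.frobenius_norm_sq_eq_trace_mul_transpose, Matrix.trace_mul_comm]

theorem Matrix.frobenius_norm_sq_split [DecidableEq n] (M : Matrix m n ℝ) {V₁ : Matrix n c ℝ}
    {V₂ : Matrix n d ℝ} (hV : V₁ * V₁ᵀ + V₂ * V₂ᵀ = 1) :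
    ‖M‖ ^ 2 = ‖M * V₁‖ ^ 2 + ‖M * V₂‖ ^ 2 := by
  simp_rw [Matrix.frobenius_norm_sq_eq_trace_mul_transpose]
  rw [← Matrix.trace_add]
  congr 1
  calc M * Mᵀ = M * (V₁ * V₁ᵀ + V₂ * V₂ᵀ) * Mᵀ := by rw [hV, Matrix.mul_one]
    _ = _ := by
      simp only [Matrix.mul_add, Matrix.add_mul, Matrix.transpose_mul, Matrix.mul_assoc]

theorem norm_sub_projection_le [DecidableEq r] (M : Matrix m n ℝ) {Q : Matrix m r ℝ}
    (hQ : Qᵀ * Q = 1) : ‖M - Q * Qᵀ * M‖ ≤ ‖M‖ := by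
  have h1 : Qᵀ * (Q * (Qᵀ * M)) = Qᵀ * M := by
    rw [← Matrix.mul_assoc, hQ, Matrix.one_mul]
  have h : ‖M‖ ^ 2 = ‖M - Q * Qᵀ * M‖ ^ 2 + ‖Qᵀ * M‖ ^ 2 := by
    simp_rw [Matrix.frobenius_norm_sq_eq_trace_transpose_mul]
    rw [← Matrix.trace_add]
    congr 1
    simp only [Matrix.transpose_sub, Matrix.transpose_mul, Matrix.transpose_transpose,
      Matrix.mul_sub, Matrix.sub_mul, Matrix.mul_assoc, h1]
    abel
  refine abs_le_of_sq_le_sq' ?_ (norm_nonneg _) |>.2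
  nlinarith [sq_nonneg ‖Qᵀ * M‖]

-- `Q Qᵀ` fixes the range of `Q`, which contains the columns of `A G`.
omit [Fintype b] in
theorem sub_projection_mul_eq_zero [DecidableEq r] {A : Matrix m n ℝ} {G : Matrix n b ℝ}
    {Q : Matrix m r ℝ} {R : Matrix r b ℝ} (hQ : Qᵀ * Q = 1) (hR : A * G = Q * R) :
    (A - Q * Qᵀ * A) * G = 0 := by
  rw [Matrix.sub_mul, Matrix.mul_assoc _ A, hR, Matrix.mul_assoc, ← Matrix.mul_assoc Qᵀ, hQ,
    Matrix.one_mul, sub_self]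

/-- The deterministic error bound for the projection onto a space containing the range of the
sample matrix `A G`. -/
theorem norm_sq_sub_projection_le [DecidableEq n] [DecidableEq r] [DecidableEq c]
    (A : Matrix m n ℝ) {V₁ : Matrix n c ℝ} {V₂ : Matrix n d ℝ} (hV : V₁ * V₁ᵀ + V₂ * V₂ᵀ = 1)
    {G : Matrix n b ℝ} {Q : Matrix m r ℝ} {R : Matrix r b ℝ} (hQ : Qᵀ * Q = 1)
    (hR : A * G = Q * R) {B : Matrix b c ℝ} (hB : V₁ᵀ * G * B = 1) :
    ‖A - Q * Qᵀ * A‖ ^ 2 ≤ ‖A * V₂‖ ^ 2 + ‖A * V₂ * (V₂ᵀ * G) * B‖ ^ 2 := by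
  set F := A - Q * Qᵀ * A with hF
  -- This is `F G B = 0` with `V₁ V₁ᵀ + V₂ V₂ᵀ = 1` inserted between `F` and `G`; it determines `F
  -- V₁` from `F V₂`.
  have h0 : F * V₁ + F * V₂ * (V₂ᵀ * G) * B = 0 := by
    calc F * V₁ + F * V₂ * (V₂ᵀ * G) * B
        = F * V₁ * (V₁ᵀ * G * B) + F * V₂ * (V₂ᵀ * G) * B := by rw [hB, Matrix.mul_one]
      _ = F * (V₁ * V₁ᵀ + V₂ * V₂ᵀ) * G * B := by
        simp only [Matrix.mul_add, Matrix.add_mul, Matrix.mul_assoc]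
      _ = 0 := by
        rw [hV, Matrix.mul_one, hF, sub_projection_mul_eq_zero hQ hR, Matrix.zero_mul]
  have h1 : ‖F * V₁‖ ≤ ‖A * V₂ * (V₂ᵀ * G) * B‖ := by
    have e : F * V₂ * (V₂ᵀ * G) * B = A * V₂ * (V₂ᵀ * G) * B -
        Q * Qᵀ * (A * V₂ * (V₂ᵀ * G) * B) := by
      simp only [hF, Matrix.sub_mul, Matrix.mul_assoc]
    rw [eq_neg_of_add_eq_zero_left h0, norm_neg, e]
    exact norm_sub_projection_le _ hQ
  have h2 : ‖F * V₂‖ ≤ ‖A * V₂‖ := by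
    have e : F * V₂ = A * V₂ - Q * Qᵀ * (A * V₂) := by
      simp only [hF, Matrix.sub_mul, Matrix.mul_assoc]
    rw [e]
    exact norm_sub_projection_le _ hQ
  rw [Matrix.frobenius_norm_sq_split F hV, add_comm]
  gcongr

end Projection

/-! ### Right singular vectors and the tail of the singular values. -/

/-- A real matrix has an orthonormal system of right singular vectors. -/
theorem exists_right_singular_vectors {m n : ℕ} (A : Matrix (Fin m) (Fin n) ℝ) :
    ∃ V : Matrix (Fin n) (Fin n) ℝ, Vᵀ * V = 1 ∧
      ∀ j, ∑ i, (A * V) i j ^ 2 = (Matrix.toEuclideanLin A).singularValues j ^ 2 := by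
  set T := Matrix.toEuclideanLin A
  have hn : Module.finrank ℝ (EuclideanSpace ℝ (Fin n)) = n := finrank_euclideanSpace_fin
  let u := T.isSymmetric_adjoint_comp_self.eigenvectorBasis hn
  refine ⟨Matrix.of fun i j => u j i, ?_, fun j => ?_⟩
  · ext j j'
    have h := orthonormal_iff_ite.1 u.orthonormal j j'
    rw [PiLp.inner_apply] at h
    rw [Matrix.mul_apply, Matrix.one_apply, ← h]
    exact Finset.sum_congr rfl fun i _ => mul_comm _ _
  · have h1 : ‖T (u j)‖ ^ 2 = T.singularValues j ^ 2 := by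
      rw [T.sq_singularValues_fin hn, ← real_inner_self_eq_norm_sq,
        ← LinearMap.adjoint_inner_right]
      have h2 := T.isSymmetric_adjoint_comp_self.apply_eigenvectorBasis hn j
      rw [LinearMap.comp_apply] at h2
      rw [h2, inner_smul_right, real_inner_self_eq_norm_sq]
      simp [u.norm_eq_one]
    rw [← h1, EuclideanSpace.norm_sq_eq]
    refine Finset.sum_congr rfl fun i _ => ?_
    rw [Real.norm_eq_abs, sq_abs]
    rfl

theorem norm_sq_tailSingularValues {m k d : ℕ} (A : Matrix (Fin m) (Fin (k + d)) ℝ) :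
    ‖tailSingularValues A k‖ ^ 2
      = ∑ j : Fin d, (Matrix.toEuclideanLin A).singularValues (k + j) ^ 2 := by
  rw [Matrix.frobenius_norm_sq, tailSingularValues]
  have h : ∀ i : Fin (k + d - k), ∑ j, Matrix.diagonal
      (fun j : Fin (k + d - k) => (Matrix.toEuclideanLin A).singularValues (k + j)) i j ^ 2
      = (Matrix.toEuclideanLin A).singularValues (k + i) ^ 2 := by
    intro i
    rw [Finset.sum_eq_single i]
    · simp
    · intro j _ hj
      simp [Matrix.diagonal_apply_ne' _ hj]
    · simp
  simp_rw [h]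
  -- Sums over ranges sidestep the mismatch between `Fin (k + d - k)` and `Fin d`.
  rw [Fin.sum_univ_eq_sum_range fun j => (Matrix.toEuclideanLin A).singularValues (k + j) ^ 2,
    Fin.sum_univ_eq_sum_range fun j => (Matrix.toEuclideanLin A).singularValues (k + j) ^ 2,
    Nat.add_sub_cancel_left]

/-! ### Mean error of the random projection. -/

section Main

variable {Ω : Type*} [MeasurableSpace Ω] {P : Measure Ω} [IsProbabilityMeasure P] {α : ℝ≥0}

omit [IsProbabilityMeasure P] in
theorem IsGaussianMatrix.orthogonal_mul {a b : Type*} [Fintype a] [Fintype b] [DecidableEq a]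
    {G : Ω → Matrix a b ℝ} (hG : IsGaussianMatrix P α G) {U : Matrix a a ℝ} (hU : U * Uᵀ = 1) :
    IsGaussianMatrix P α fun ω => U * G ω := by
  classical
  refine IsGaussianFamily.matrix ?_
  -- Left multiplication by `U` acts on the family of entries as the Kronecker product of `U` and
  -- the identity, which has orthonormal rows.
  have h := hG.family.orthonormal_comb (Matrix.kroneckerMap (· * ·) U (1 : Matrix b b ℝ)) (by
    have := Matrix.mul_kronecker_mul U Uᵀ (1 : Matrix b b ℝ)
      (1 : Matrix b b ℝ)
    rw [hU, Matrix.one_mul, Matrix.one_kronecker_one] at this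
    rw [this, ← Matrix.kroneckerMap_transpose, Matrix.transpose_one])
  convert h using 2 with z
  funext ω
  rw [Fintype.sum_prod_type, Matrix.mul_apply]
  refine Finset.sum_congr rfl fun j _ => ?_
  simp [Matrix.kroneckerMap_apply, Matrix.one_apply, entries]

omit [IsProbabilityMeasure P] in
theorem IsGaussianMatrix.submatrix {a a' b : Type*} {G : Ω → Matrix a b ℝ}
    (hG : IsGaussianMatrix P α G) {g : a' → a} (hg : Function.Injective g) :
    IsGaussianMatrix P α fun ω => (G ω).submatrix g id :=
  IsGaussianFamily.matrix (hG.family.precomp (g := fun z : a' × b => (g z.1, z.2))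
    fun _ _ h => Prod.ext (hg (Prod.ext_iff.1 h).1) (Prod.ext_iff.1 h).2)

theorem memLp_norm_sub_projection {m n r : Type*} [Fintype m] [Fintype n] [Fintype r]
    [DecidableEq r] (A : Matrix m n ℝ) {Q : Ω → Matrix m r ℝ}
    (hQm : ∀ i j, AEMeasurable (fun ω => Q ω i j) P) (hQ : ∀ᵐ ω ∂P, (Q ω)ᵀ * Q ω = 1) :
    MemLp (fun ω => ‖A - Q ω * (Q ω)ᵀ * A‖) 2 P := by
  refine MemLp.of_bound ?_ ‖A‖ ?_
  · have h : ∀ ω, ‖A - Q ω * (Q ω)ᵀ * A‖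
        = √(∑ i, ∑ j, (A i j - ∑ s, (∑ t, Q ω i t * Q ω s t) * A s j) ^ 2) := by
      intro ω
      rw [← Real.sqrt_sq (norm_nonneg (A - _)), Matrix.frobenius_norm_sq]
      simp [Matrix.mul_apply]
    simp_rw [h]
    refine (AEMeasurable.sqrt ?_).aestronglyMeasurable
    fun_prop
  · filter_upwards [hQ] with ω hω
    rw [norm_norm]
    exact norm_sub_projection_le A hω

theorem sq_integral_le_integral_sq {f : Ω → ℝ} (hf : MemLp f 2 P) :
    (∫ ω, f ω ∂P) ^ 2 ≤ ∫ ω, f ω ^ 2 ∂P := by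
  have h := variance_nonneg f P
  rw [variance_eq_sub hf] at h
  simpa using h

/-- The expected error of the randomized range finder. -/
theorem integral_norm_sub_projection_le (hα : 0 < α) {k p m n r : ℕ} (hp : 2 ≤ p)
    (A : Matrix (Fin m) (Fin n) ℝ) {G : Ω → Matrix (Fin n) (Fin (k + p)) ℝ}
    {Q : Ω → Matrix (Fin m) (Fin r) ℝ} (hG : IsGaussianMatrix P α G)
    (hQm : ∀ i j, AEMeasurable (fun ω => Q ω i j) P)
    (hQ : ∀ᵐ ω ∂P, (Q ω)ᵀ * Q ω = 1 ∧
      ∃ R : Matrix (Fin r) (Fin (k + p)) ℝ, A * G ω = Q ω * R) :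
    ∫ ω, ‖A - Q ω * (Q ω)ᵀ * A‖ ∂P
      ≤ √(1 + (k : ℝ) / ((p : ℝ) - 1)) * ‖tailSingularValues A k‖ := by
  have hp' : (0 : ℝ) < (p : ℝ) - 1 := by
    have : (2 : ℝ) ≤ p := by exact_mod_cast hp
    linarith
  rcases lt_or_ge n k with hnk | hkn
  -- When `n < k` the tail is empty and `V₁` cannot have `k` columns. But `G` itself then has a
  -- right inverse almost surely, so an error that kills `G` is zero.
  · have h0 : (fun ω => ‖A - Q ω * (Q ω)ᵀ * A‖) =ᵐ[P] fun _ => 0 := by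
      filter_upwards [hQ, hG.ae_mul_pinv hα (by simp; omega)] with ω hω hpinv
      obtain ⟨h1, R, hR⟩ := hω
      rw [← Matrix.mul_one (A - _), ← hpinv, ← Matrix.mul_assoc,
        sub_projection_mul_eq_zero h1 hR, Matrix.zero_mul, norm_zero]
    rw [integral_congr_ae h0, integral_zero]
    positivity
  · obtain ⟨d, rfl⟩ := Nat.exists_eq_add_of_le hkn
    obtain ⟨V, hV, hσ⟩ := exists_right_singular_vectors A
    have hV' : V * Vᵀ = 1 := mul_eq_one_comm.1 hV
    set V₁ := V.submatrix id (Fin.castAdd d) with hV₁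
    set V₂ := V.submatrix id (Fin.natAdd k) with hV₂
    have hVV : V₁ * V₁ᵀ + V₂ * V₂ᵀ = 1 := by
      rw [← hV']
      ext i j
      simp [Matrix.mul_apply, Fin.sum_univ_add, hV₁, hV₂]
    have hGV : IsGaussianMatrix P α fun ω => Vᵀ * G ω :=
      hG.orthogonal_mul (by rwa [Matrix.transpose_transpose])
    have hG₁ : IsGaussianMatrix P α fun ω => V₁ᵀ * G ω :=
      hGV.submatrix (Fin.castAdd_injective k d)
    have hG₂ : IsGaussianMatrix P α fun ω => V₂ᵀ * G ω :=
      hGV.submatrix (Fin.natAdd_injective d k)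
    -- The two matrices are disjoint blocks of rows of the single Gaussian matrix `Vᵀ G`.
    have hind : IndepFun (entries fun ω => V₁ᵀ * G ω) (entries fun ω => V₂ᵀ * G ω) P :=
      hGV.family.indepFun_of_disjoint
        (fun z : Fin k × Fin (k + p) => (Fin.castAdd d z.1, z.2))
        (fun z : Fin d × Fin (k + p) => (Fin.natAdd k z.1, z.2)) fun z z' h => by
          have := congrArg Fin.val (Prod.ext_iff.1 h).1
          simp at this
          omega
    have hcard : Fintype.card (Fin k) + 2 ≤ Fintype.card (Fin (k + p)) := by simpa using hp
    obtain ⟨hint, hval⟩ := hG₁.integral_norm_sq_mul_pinv hG₂ hind hα hcard (A * V₂)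
    have htail : ‖A * V₂‖ ^ 2 = ‖tailSingularValues A k‖ ^ 2 := by
      rw [norm_sq_tailSingularValues, Matrix.frobenius_norm_sq, Finset.sum_comm]
      exact Finset.sum_congr rfl fun j _ => hσ (Fin.natAdd k j)
    have hL2 := memLp_norm_sub_projection A hQm (hQ.mono fun ω h => h.1)
    have hle : ∫ ω, ‖A - Q ω * (Q ω)ᵀ * A‖ ^ 2 ∂P
        ≤ (1 + (k : ℝ) / ((p : ℝ) - 1)) * ‖tailSingularValues A k‖ ^ 2 := by
      calc _ ≤ ∫ ω, (‖A * V₂‖ ^ 2 + ‖A * V₂ * (V₂ᵀ * G ω) * pinv (V₁ᵀ * G ω)‖ ^ 2) ∂P := by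
            refine integral_mono_ae hL2.integrable_sq ((integrable_const _).add hint) ?_
            filter_upwards [hQ, hG₁.ae_mul_pinv hα hcard] with ω hω hpinv
            obtain ⟨h1, R, hR⟩ := hω
            exact norm_sq_sub_projection_le A hVV h1 hR hpinv
        _ = _ := by
            rw [integral_add (integrable_const _) hint, hval, htail]
            simp
            ring
    have h := (sq_integral_le_integral_sq hL2).trans hle
    rw [← Real.sq_sqrt (show 0 ≤ 1 + (k : ℝ) / ((p : ℝ) - 1) by positivity), ← mul_pow] at h
    exact (abs_le_of_sq_le_sq' h (by positivity)).2

end Main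

theorem mainTheorem3 {Ω : Type*} [MeasurableSpace Ω] (P : Measure Ω) [IsProbabilityMeasure P]
    (α : ℝ≥0) (hα : 0 < α) (k p : ℕ) (hp : 2 ≤ p) :
    -- the second-moment identity, with a value that does not depend on the variance
    (∀ (q r : ℕ) (S : Matrix (Fin q) (Fin r) ℝ)
        (G₁ : Ω → Matrix (Fin k) (Fin (k + p)) ℝ) (G₂ : Ω → Matrix (Fin r) (Fin (k + p)) ℝ),
        IsGaussianMatrix P α G₁ → IsGaussianMatrix P α G₂ →
        IndepFun (entries G₁) (entries G₂) P →
        Integrable (fun ω => ‖S * G₂ ω * pinv (G₁ ω)‖ ^ 2) P ∧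
        ∫ ω, ‖S * G₂ ω * pinv (G₁ ω)‖ ^ 2 ∂P = (k : ℝ) / ((p : ℝ) - 1) * ‖S‖ ^ 2) ∧
    -- the expected error of the random projection; the columns of `Q` are orthonormal and
    -- their span contains the range of `A * G`, as in a QR factorization of `A * G`
    (∀ (m n r : ℕ) (A : Matrix (Fin m) (Fin n) ℝ) (G : Ω → Matrix (Fin n) (Fin (k + p)) ℝ)
        (Q : Ω → Matrix (Fin m) (Fin r) ℝ),
        IsGaussianMatrix P α G →
        (∀ i j, AEMeasurable (fun ω => Q ω i j) P) →
        (∀ᵐ ω ∂P, (Q ω)ᵀ * Q ω = 1 ∧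
          ∃ R : Matrix (Fin r) (Fin (k + p)) ℝ, A * G ω = Q ω * R) →
        Integrable (fun ω => ‖A - Q ω * (Q ω)ᵀ * A‖) P ∧
        ∫ ω, ‖A - Q ω * (Q ω)ᵀ * A‖ ∂P ≤
          √(1 + (k : ℝ) / ((p : ℝ) - 1)) * ‖tailSingularValues A k‖) := by
  refine ⟨fun q r S G₁ G₂ h₁ h₂ hind => ?_, fun m n r A G Q hG hQm hQ => ⟨?_, ?_⟩⟩
  · have h := h₁.integral_norm_sq_mul_pinv h₂ hind hα (by simpa using hp) S
    simpa using h
  · exact (memLp_norm_sub_projection A hQm (hQ.mono fun ω h => h.1)).integrable one_le_two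
  · exact integral_norm_sub_projection_le hα hp A hG hQm hQ
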